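/- Let $K$ be an algebraically closed field of characteristic zero, let $G$ be a finite abelian group with character group $\hat G=\operatorname{Hom}(G,K^\times)$, and let $A$ be a commutative semisimple left Yetter-Drinfel'd Hopf algebra over the group ring $H=K[G]$. That is, $A$ is an algebra and a coalgebra over $K$ and a left Yetter-Drinfel'd module over $H$ with coaction $\delta(a)=a^{(1)}\otimes a^{(2)}\in H\otimes A$; its product, unit, coproduct and counit are $H$-linear and colinear; the counit $A\to K$ and the coproduct $\Delta\colon A\to A\mathbin{\hat\otimes}A$ are algebra homomorphisms, where $A\mathbin{\hat\otimes}A$ is $A\otimes A$ with the product $(a\otimes a')(b\otimes b')=a(a'^{(1)}.b)\otimes a'^{(2)}b'$; and $A$ has an $H$-linear and colinear antipode. For $g\in G$ and $\gamma\in\hat G$ put $\phi_g(a)=g.a$ and $\psi_\gamma(a)=\gamma(a^{(1)})\,a^{(2)}$, and let $\phi_g^*,\psi_\gamma^*$ be the transposed maps on $A^*$. The product of $\varphi,\varphi'\in A^*$ is $\varphi\varphi'=(\varphi\otimes\varphi')\circ\Delta$. A character of $A$ is an algebra homomorphism $A\to K$. For $Q\subset\hat G$ and $T\subset G$ let $Q^\perp=\{g\in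 G\mid \gamma(g)=1\ \forall\gamma\in Q\}$ and $T^\perp=\{\gamma\in\hat G\mid\gamma(g)=1\ \forall g\in T\}$. For every primitive idempotent $e$ of $A$ there is a unique character $\eta_e$ of $A$ such that $\eta_e(e)=1$ and $\eta_e(e')=0$ for all primitive idempotents $e'\neq e$. Put $T_e=\{g\in G\mid\phi_g(e)=e\}$ and $Q_e=\{\gamma\in\hat G\mid\psi_\gamma(e)=e\}$. Let $e$ and $e'$ be primitive idempotents of $A$, and put $$O=\{\phi_g(e)\mid g\in Q_{e'}^\perp\},\qquad O'=\{\psi_\gamma(e')\mid\gamma\in T_e^\perp\},\qquad m=|O|.$$ Then there are $m$ distinct characters $\omega_1,\dots,\omega_m$ of $A$ with the following properties. 1. $\eta_{\tilde e}\,\eta_{\tilde e'}\in\operatorname{Span}(\omega_1,\dots,\omega_m)$ for all $\tilde e\in O$ and all $\tilde e'\in O'$. In particular, $\eta_e\eta_{e'}\in\operatorname{Span}(\omega_1,\dots,\omega_m)$. 2. If $\gamma\in T_e^\perp$ and $O$ is stable under $\psi_\gamma$, then $\{\omega_1,\dots,\omega_m\}$ is stable under $\psi_\gamma^*$. 3.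 If $g\in Q_{e'}^\perp$ and $O'$ is stable under $\phi_g$, then $\{\omega_1,\dots,\omega_m\}$ is stable under $\phi_g^*$. -/

import Mathlib

open scoped TensorProduct

noncomputable section

namespace YetterDrinfeld

section Modules

variable (K : Type*) (H : Type*) [Field K] [Ring H] [HopfAlgebra K H]

/-- The linear map `H ⊗ (H ⊗ H) → End (H ⊗ V)` that sends `x ⊗ (y ⊗ z)` to the map
`a ⊗ v ↦ x a S(z) ⊗ y.v`. -/
def twistedAction (V : Type*) [AddCommGroup V] [Module K V] [Module H V] [IsScalarTower K H V] :
    H ⊗[K] (H ⊗[K] H) →ₗ[K] Module.End K (H ⊗[K] V) :=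
  LinearMap.mul' K (Module.End K (H ⊗[K] V)) ∘ₗ
    TensorProduct.map
      (LinearMap.rTensorHom V ∘ₗ LinearMap.mul K H)
      (LinearMap.mul' K (Module.End K (H ⊗[K] V)) ∘ₗ
        TensorProduct.map
          (LinearMap.lTensorHom H ∘ₗ (Algebra.lsmul K K V : H →ₐ[K] Module.End K V).toLinearMap)
          (LinearMap.rTensorHom V ∘ₗ (LinearMap.mul K H).flip ∘ₗ HopfAlgebra.antipode K))

/-- A left Yetter-Drinfel'd module over the Hopf algebra `H`: a left `H`-module `V` together with
a left `H`-coaction `δ(v) = v⁽¹⁾ ⊗ v⁽²⁾` (coassociative and counital) such that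
`δ(h.v) = h₍₁₎ v⁽¹⁾ S(h₍₃₎) ⊗ h₍₂₎.v⁽²⁾`. -/
class YDModule (V : Type*) [AddCommGroup V] [Module K V] [Module H V] [IsScalarTower K H V] where
  /-- The coaction `δ`. -/
  coaction : V →ₗ[K] H ⊗[K] V
  coaction_coassoc :
    TensorProduct.assoc K H H V ∘ₗ LinearMap.rTensor V (Coalgebra.comul (R := K)) ∘ₗ coaction =
      LinearMap.lTensor H coaction ∘ₗ coaction
  coaction_counit :
    TensorProduct.lid K V ∘ₗ LinearMap.rTensor V (Coalgebra.counit (R := K)) ∘ₗ coaction =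
      LinearMap.id
  coaction_smul : ∀ (h : H) (v : V),
    coaction (h • v) =
      twistedAction K H V
        (LinearMap.lTensor H (Coalgebra.comul (R := K)) (Coalgebra.comul (R := K) h)) (coaction v)

variable (V W : Type*) [AddCommGroup V] [Module K V] [Module H V] [IsScalarTower K H V]
  [AddCommGroup W] [Module K W] [Module H W] [IsScalarTower K H W]

/-- The module structure as a linear map `H ⊗ V → V`, `h ⊗ v ↦ h.v`. -/
def actionMap : H ⊗[K] V →ₗ[K] V :=
  TensorProduct.lift (Algebra.lsmul K K V : H →ₐ[K] Module.End K V).toLinearMap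

/-- The diagonal action on `V ⊗ W`: `h.(v ⊗ w) = h₍₁₎.v ⊗ h₍₂₎.w`. -/
def diagonalAction : H →ₗ[K] Module.End K (V ⊗[K] W) :=
  TensorProduct.homTensorHomMap (RingHom.id K) V W V W ∘ₗ
    TensorProduct.map (Algebra.lsmul K K V : H →ₐ[K] Module.End K V).toLinearMap
      (Algebra.lsmul K K W : H →ₐ[K] Module.End K W).toLinearMap ∘ₗ
    Coalgebra.comul

/-- The codiagonal coaction on `V ⊗ W`:
`v ⊗ w ↦ v⁽¹⁾ w⁽¹⁾ ⊗ (v⁽²⁾ ⊗ w⁽²⁾)`. -/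
def codiagonalCoaction [YDModule K H V] [YDModule K H W] :
    V ⊗[K] W →ₗ[K] H ⊗[K] (V ⊗[K] W) :=
  LinearMap.rTensor (V ⊗[K] W) (LinearMap.mul' K H) ∘ₗ
    TensorProduct.tensorTensorTensorComm K H V H W ∘ₗ
    TensorProduct.map (YDModule.coaction (K := K) (H := H) (V := V))
      (YDModule.coaction (K := K) (H := H) (V := W))

/-- The quasisymmetry `σ : V ⊗ W → W ⊗ V`, `v ⊗ w ↦ v⁽¹⁾.w ⊗ v⁽²⁾`. -/
def quasisymmetry [YDModule K H V] : V ⊗[K] W →ₗ[K] W ⊗[K] V :=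
  LinearMap.rTensor V (actionMap K H W) ∘ₗ
    TensorProduct.rightComm K H V W ∘ₗ
    LinearMap.rTensor W (YDModule.coaction (K := K) (H := H) (V := V))

end Modules

section HopfAlgebras

variable (K : Type*) (H : Type*) [Field K] [Ring H] [HopfAlgebra K H]

/-- The multiplication of `A ⊗̂ A`, namely `(μ ⊗ μ) ∘ (id ⊗ σ ⊗ id)`, i.e.
`(a ⊗ a')(b ⊗ b') = a (a'⁽¹⁾.b) ⊗ a'⁽²⁾ b'`. -/
def braidedMul (A : Type*) [Ring A] [Algebra K A] [Module H A] [IsScalarTower K H A]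
    [YDModule K H A] : (A ⊗[K] A) ⊗[K] (A ⊗[K] A) →ₗ[K] A ⊗[K] A :=
  TensorProduct.map (LinearMap.mul' K A) (LinearMap.mul' K A) ∘ₗ
    (TensorProduct.assoc K A A (A ⊗[K] A)).symm.toLinearMap ∘ₗ
    LinearMap.lTensor A
      ((TensorProduct.assoc K A A A).toLinearMap ∘ₗ
        LinearMap.rTensor A (quasisymmetry K H A A) ∘ₗ
        (TensorProduct.assoc K A A A).symm.toLinearMap) ∘ₗ
    (TensorProduct.assoc K A A (A ⊗[K] A)).toLinearMap

/-- A left Yetter-Drinfel'd Hopf algebra over the Hopf algebra `H`: an algebra and coalgebra `A`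
that is a left Yetter-Drinfel'd module, such that product, unit, coproduct and counit are
`H`-linear and colinear, the counit `A → K` and the coproduct `A → A ⊗̂ A` are algebra
homomorphisms, and there is an `H`-linear and colinear antipode. The base field carries the
trivial action and coaction. -/
class YDHopfAlgebra (A : Type*) [Ring A] [Algebra K A] [Coalgebra K A] [Module H A]
    [IsScalarTower K H A] extends YDModule K H A where
  -- product and unit are linear and colinear
  smul_mul : ∀ h : H,
    LinearMap.mul' K A ∘ₗ diagonalAction K H A A h =
      (Algebra.lsmul K K A : H →ₐ[K] Module.End K A) h ∘ₗ LinearMap.mul' K A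
  smul_one : ∀ h : H, h • (1 : A) = algebraMap K A (Coalgebra.counit (R := K) h)
  coaction_mul :
    coaction ∘ₗ LinearMap.mul' K A =
      LinearMap.lTensor H (LinearMap.mul' K A) ∘ₗ codiagonalCoaction K H A A
  coaction_one : coaction 1 = 1 ⊗ₜ[K] 1
  -- coproduct and counit are linear and colinear
  comul_smul : ∀ (h : H) (a : A),
    Coalgebra.comul (R := K) (h • a) = diagonalAction K H A A h (Coalgebra.comul (R := K) a)
  counit_smul : ∀ (h : H) (a : A),
    Coalgebra.counit (R := K) (h • a) = Coalgebra.counit (R := K) h * Coalgebra.counit (R := K) a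
  coaction_comul :
    LinearMap.lTensor H (Coalgebra.comul (R := K)) ∘ₗ coaction =
      codiagonalCoaction K H A A ∘ₗ Coalgebra.comul (R := K)
  coaction_counit_right : ∀ a : A,
    LinearMap.lTensor H (Coalgebra.counit (R := K)) (coaction a) =
      1 ⊗ₜ[K] Coalgebra.counit (R := K) a
  -- coproduct and counit are algebra homomorphisms
  comul_mul : ∀ a b : A,
    Coalgebra.comul (R := K) (a * b) =
      braidedMul K H A (Coalgebra.comul (R := K) a ⊗ₜ[K] Coalgebra.comul (R := K) b)
  comul_one : Coalgebra.comul (R := K) (1 : A) = 1 ⊗ₜ[K] 1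
  counit_mul : ∀ a b : A,
    Coalgebra.counit (R := K) (a * b) = Coalgebra.counit (R := K) a * Coalgebra.counit (R := K) b
  counit_one : Coalgebra.counit (R := K) (1 : A) = 1
  /-- The antipode. -/
  antipode : A →ₗ[K] A
  antipode_smul : ∀ (h : H) (a : A), antipode (h • a) = h • antipode a
  coaction_antipode : coaction ∘ₗ antipode = LinearMap.lTensor H antipode ∘ₗ coaction
  mul_antipode_rTensor_comul :
    LinearMap.mul' K A ∘ₗ LinearMap.rTensor A antipode ∘ₗ Coalgebra.comul =
      Algebra.linearMap K A ∘ₗ Coalgebra.counit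
  mul_antipode_lTensor_comul :
    LinearMap.mul' K A ∘ₗ LinearMap.lTensor A antipode ∘ₗ Coalgebra.comul =
      Algebra.linearMap K A ∘ₗ Coalgebra.counit

end HopfAlgebras

section GroupRings

variable {K G A : Type*} [Field K] [CommGroup G]

/-- `Q^⊥ = {g ∈ G | γ(g) = 1 for all γ ∈ Q}` for a set `Q` of characters of `G`. -/
def perpChars (Q : Set (G →* Kˣ)) : Set G := {g | ∀ γ ∈ Q, γ g = 1}

variable (K) in
/-- `T^⊥ = {γ ∈ Ĝ | γ(g) = 1 for all g ∈ T}` for a subset `T` of `G`. -/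
def perpGroup (T : Set G) : Set (G →* Kˣ) := {γ | ∀ g ∈ T, γ g = 1}

variable [Ring A] [Algebra K A] [Module (MonoidAlgebra K G) A]
  [IsScalarTower K (MonoidAlgebra K G) A]

variable (K A) in
/-- `φ_g(a) = g.a`. -/
def phi (g : G) : A →ₗ[K] A :=
  (Algebra.lsmul K K A : MonoidAlgebra K G →ₐ[K] Module.End K A) (MonoidAlgebra.of K G g)

/-- The linear extension of a group character to the group ring. -/
def extendChar (γ : G →* Kˣ) : MonoidAlgebra K G →ₗ[K] K :=
  (MonoidAlgebra.lift K K G ((Units.coeHom K).comp γ)).toLinearMap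

variable (A) in
/-- `ψ_γ(a) = γ(a⁽¹⁾) a⁽²⁾`. -/
def psi [YDModule K (MonoidAlgebra K G) A] (γ : G →* Kˣ) : A →ₗ[K] A :=
  TensorProduct.lid K A ∘ₗ LinearMap.rTensor A (extendChar γ) ∘ₗ
    YDModule.coaction (K := K) (H := MonoidAlgebra K G) (V := A)

/-- A primitive idempotent: a nonzero idempotent that is not the sum of two nonzero orthogonal
idempotents. -/
def IsPrimitiveIdempotent (e : A) : Prop :=
  IsIdempotentElem e ∧ e ≠ 0 ∧
    ∀ f f' : A, IsIdempotentElem f → IsIdempotentElem f' → f * f' = 0 → f' * f = 0 →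
      e = f + f' → f = 0 ∨ f' = 0

variable (K) in
/-- `η` is the character associated with the primitive idempotent `e`: it takes the value `1` on
`e` and `0` on all other primitive idempotents. -/
def IsCharacterOf (e : A) (η : A →ₐ[K] K) : Prop :=
  η e = 1 ∧ ∀ e' : A, IsPrimitiveIdempotent e' → e' ≠ e → η e' = 0

open Classical in
variable (K) in
/-- The character `η_e`, as an element of `A^*` (zero if there is no such character). -/
def eta (e : A) : Module.Dual K A :=
  if h : ∃ η : A →ₐ[K] K, IsCharacterOf K e η then h.choose.toLinearMap else 0

/-- The product `⟨a, φφ'⟩ = ⟨Δ(a), φ ⊗ φ'⟩` of `A^*`. -/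
def dualMul [Coalgebra K A] (φ φ' : Module.Dual K A) : Module.Dual K A :=
  (WithConv.toConv φ * WithConv.toConv φ').ofConv

variable (K G) in
/-- The inertia group `T_e`. -/
def inertia (e : A) : Set G := {g | phi K A g e = e}

variable (K G) in
/-- The isotropy group `Q_e`. -/
def isotropy [YDModule K (MonoidAlgebra K G) A] (e : A) : Set (G →* Kˣ) := {γ | psi A γ e = e}

variable (K G) in
/-- The orbit `O` of `e` under `Q_{e'}^⊥`. -/
def orbitO [YDModule K (MonoidAlgebra K G) A] (e e' : A) : Set A :=
  (fun g : G => phi K A g e) '' perpChars (isotropy K G e')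

variable (K G) in
/-- The orbit `O'` of `e'` under `T_e^⊥`. -/
def orbitO' [YDModule K (MonoidAlgebra K G) A] (e e' : A) : Set A :=
  (fun γ : G →* Kˣ => psi A γ e') '' perpGroup K (inertia K G e)

end GroupRings

end YetterDrinfeld

end

/-!
The coaction of `K[G]` on `A` is a `G`-grading with projections `pₖ`, and `ψ_γ` is multiplication
by `γ(k)` in degree `k`. If `t` is an integral of `A` with `ε(t) = 1`, the right tensor factors of
`Δ(t)` span a finite-dimensional ideal containing `1`, so that `A` is finite-dimensional
(`finite_of_isSemisimpleRing`). Hence `A` is a product of copies of `K`: characters and primitive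
idempotents are dual to each other (`dualIdempotent`), and automorphisms of `A` permute both.

Let `η = η_e` and `η' = η_{e'}`. The multiplicativity of the coproduct reads
`(χχ')(ab) = ∑ₖ (χ(χ' ∘ pₖ))(a) ((χ ∘ φₖ)χ')(b)` for characters `χ` and `χ'` (`dualMul_apply_mul`).
Here `η' ∘ pₖ = 0` unless `k ∈ Q_{e'}^⊥`, so that the span `W` of the products `η_f η_{f'}` with
`f ∈ O` and `f' ∈ O'` is stable under translations. Such a space is spanned by the characters it
contains (`eq_span_characters`); these are the `ωᵢ`, and the stability properties follow because
`φ_g` and `ψ_γ` respect the coproduct (`dualMap_image_support`).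

It remains to see that `W` has dimension `|O|`. It is at least that, because the characters `η_f`
with `f ∈ O` are linearly independent and multiplication by `η'` is injective: `η'` is invertible
in `A^*` with inverse `η' ∘ S`. For the upper bound, `v_γ(g) = γ(g) ((η ∘ φ_g)(η' ∘ ψ_γ))(b)` with
`γ ∈ T_e^⊥` and `g ∈ Q_{e'}^⊥` depends, for fixed `b`, only on the character `η ∘ φ_g`, so it is a
function on `O`. By the product formula, replacing `b` by `ab` amounts to applying to `v_γ` an
operator that depends only on `a` (`rescaled_dualMul_apply_mul`). If `a` and `b` run over the
idempotents of the characters in `W`, one gets linearly independent vectors in `K^O`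
(`ncard_support_le`).
-/

noncomputable section

namespace YetterDrinfeld

/-! ### The grading defined by the coaction -/

section Coaction

variable {K G A : Type*} [Field K] [CommGroup G] [Ring A] [Algebra K A]
  [Module (MonoidAlgebra K G) A] [IsScalarTower K (MonoidAlgebra K G) A]

/-- The coefficient of `k`, as a linear form on the group ring. -/
def coeffForm (K : Type*) {G : Type*} [Field K] [CommGroup G] (k : G) : MonoidAlgebra K G →ₗ[K] K :=
  Finsupp.lapply k ∘ₗ (MonoidAlgebra.coeffLinearEquiv K).toLinearMap

lemma coeffForm_single [DecidableEq G] (k g : G) (r : K) :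
    coeffForm K k (MonoidAlgebra.single g r) = if g = k then r else 0 := by
  simp [coeffForm, Finsupp.single_apply]

lemma extendChar_single (γ : G →* Kˣ) (g : G) (r : K) :
    extendChar γ (MonoidAlgebra.single g r) = r * γ g := by
  simp [extendChar]

lemma phi_apply (g : G) (a : A) : phi K A g a = MonoidAlgebra.single g (1 : K) • a := rfl

lemma phi_mul_apply (g h : G) (a : A) : phi K A (g * h) a = phi K A g (phi K A h a) := by
  simp only [phi_apply, smul_smul, MonoidAlgebra.single_mul_single, mul_one]

lemma phi_one_apply (a : A) : phi K A (1 : G) a = a := by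
  rw [phi_apply, ← MonoidAlgebra.one_def, one_smul]

lemma phi_inv_apply_phi (g : G) (a : A) : phi K A g⁻¹ (phi K A g a) = a := by
  rw [← phi_mul_apply, inv_mul_cancel, phi_one_apply]

lemma phi_apply_phi_inv (g : G) (a : A) : phi K A g (phi K A g⁻¹ a) = a := by
  rw [← phi_mul_apply, mul_inv_cancel, phi_one_apply]

lemma tensor_eq_sum_single [Fintype G] (V : Type*) [AddCommGroup V] [Module K V]
    (x : MonoidAlgebra K G ⊗[K] V) :
    x = ∑ k : G, MonoidAlgebra.single k (1 : K) ⊗ₜ[K]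
      TensorProduct.lid K V (LinearMap.rTensor V (coeffForm K k) x) := by
  classical
  induction x with
  | zero => simp
  | add x y hx hy =>
    simp only [map_add, TensorProduct.tmul_add, Finset.sum_add_distrib]
    rw [← hx, ← hy]
  | tmul h v =>
    simp only [LinearMap.rTensor_tmul, TensorProduct.lid_tmul, ← TensorProduct.smul_tmul,
      ← TensorProduct.sum_tmul]
    congr 1
    induction h using MonoidAlgebra.induction_linear with
    | zero => simp
    | add f g hf hg =>
      simp only [map_add, add_smul, Finset.sum_add_distrib]
      rw [← hf, ← hg]
    | single g r => simp [coeffForm_single]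

variable [YDModule K (MonoidAlgebra K G) A]

variable (K A) in
/-- The projection of `A` onto its homogeneous component of degree `k`, where the coaction is
viewed as a `G`-grading. -/
def component (k : G) : A →ₗ[K] A :=
  TensorProduct.lid K A ∘ₗ LinearMap.rTensor A (coeffForm K k) ∘ₗ
    YDModule.coaction (K := K) (H := MonoidAlgebra K G) (V := A)

variable [Fintype G]

lemma coaction_eq_sum (a : A) :
    YDModule.coaction (K := K) (H := MonoidAlgebra K G) a =
      ∑ k : G, MonoidAlgebra.single k (1 : K) ⊗ₜ[K] component K A k a :=
  tensor_eq_sum_single A _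

lemma psi_eq_sum (γ : G →* Kˣ) (a : A) :
    psi A γ a = ∑ k : G, (γ k : K) • component K A k a := by
  simp [psi, coaction_eq_sum, extendChar_single]

lemma sum_component (a : A) : ∑ k : G, component K A k a = a := by
  have h := LinearMap.congr_fun
    (YDModule.coaction_counit (K := K) (H := MonoidAlgebra K G) (V := A)) a
  simpa [coaction_eq_sum] using h

lemma component_component [DecidableEq G] (k l : G) (a : A) :
    component K A l (component K A k a) = if k = l then component K A k a else 0 := by
  have h := LinearMap.congr_fun
    (YDModule.coaction_coassoc (K := K) (H := MonoidAlgebra K G) (V := A)) a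
  have h2 := congr(TensorProduct.lid K A (LinearMap.rTensor A (coeffForm K l)
    (TensorProduct.lid K _ (LinearMap.rTensor _ (coeffForm K k) $h))))
  simp [coaction_eq_sum, coeffForm_single] at h2
  exact h2.symm

lemma psi_component (γ : G →* Kˣ) (k : G) (a : A) :
    psi A γ (component K A k a) = (γ k : K) • component K A k a := by
  classical
  simp [psi_eq_sum, component_component]

lemma psi_mul_apply (γ χ : G →* Kˣ) (a : A) : psi A (γ * χ) a = psi A γ (psi A χ a) := by
  simp only [psi_eq_sum χ a, psi_eq_sum (γ * χ) a, map_sum, map_smul, psi_component, smul_smul]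
  simp [mul_comm]

lemma psi_one_apply (a : A) : psi A (1 : G →* Kˣ) a = a := by
  simp [psi_eq_sum, sum_component]

lemma psi_inv_apply_psi (γ : G →* Kˣ) (a : A) : psi A γ⁻¹ (psi A γ a) = a := by
  rw [← psi_mul_apply, show γ⁻¹ * γ = 1 from inv_mul_cancel γ, psi_one_apply]

lemma psi_apply_psi_inv (γ : G →* Kˣ) (a : A) : psi A γ (psi A γ⁻¹ a) = a := by
  rw [← psi_mul_apply, show γ * γ⁻¹ = 1 from mul_inv_cancel γ, psi_one_apply]

end Coaction

section Contraction

variable {K : Type*} [Field K]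

lemma lid_rTensor_lTensor {U V W : Type*} [AddCommGroup U] [Module K U] [AddCommGroup V] [Module K V]
    [AddCommGroup W] [Module K W]
    (l : U →ₗ[K] K) (f : V →ₗ[K] W) (x : U ⊗[K] V) :
    TensorProduct.lid K W (LinearMap.rTensor W l (LinearMap.lTensor _ f x)) =
      f (TensorProduct.lid K V (LinearMap.rTensor V l x)) := by
  induction x with
  | zero => simp
  | add x y hx hy => simp only [map_add, hx, hy]
  | tmul h v => simp

end Contraction

section HopfAlgebra

variable {K G A : Type*} [Field K] [CommGroup G] [Ring A] [Algebra K A] [Coalgebra K A]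
  [Module (MonoidAlgebra K G) A] [IsScalarTower K (MonoidAlgebra K G) A]
  [YDHopfAlgebra K (MonoidAlgebra K G) A]

lemma phi_mul (g : G) (a b : A) : phi K A g (a * b) = phi K A g a * phi K A g b := by
  have h := LinearMap.congr_fun (YDHopfAlgebra.smul_mul (K := K) (H := MonoidAlgebra K G) (A := A)
    (MonoidAlgebra.single g (1 : K))) (a ⊗ₜ b)
  simpa [diagonalAction, MonoidAlgebra.comul_single, phi_apply] using h.symm

lemma phi_map_one (g : G) : phi K A g 1 = 1 := by
  rw [phi_apply, YDHopfAlgebra.smul_one (K := K)]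
  simp

lemma comul_phi (g : G) (a : A) :
    Coalgebra.comul (R := K) (phi K A g a) =
      TensorProduct.map (phi K A g) (phi K A g) (Coalgebra.comul (R := K) a) := by
  rw [phi_apply, YDHopfAlgebra.comul_smul]
  simp only [diagonalAction, LinearMap.comp_apply, MonoidAlgebra.comul_single]
  simp
  rfl

/-- Since `γ` is multiplicative, `ψ_γ` acts diagonally on `A ⊗ A`. -/
lemma contract_codiagonalCoaction (γ : G →* Kˣ) (x : A ⊗[K] A) :
    TensorProduct.lid K _ (LinearMap.rTensor _ (extendChar γ)
      (codiagonalCoaction K (MonoidAlgebra K G) A A x)) =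
      TensorProduct.map (psi A γ) (psi A γ) x := by
  have hmul (h h' : MonoidAlgebra K G) :
      extendChar γ (h * h') = extendChar γ h * extendChar γ h' := by
    simp [extendChar]
  induction x with
  | zero => simp
  | add x y hx hy => simp only [map_add, hx, hy]
  | tmul a b =>
    simp only [codiagonalCoaction, psi, LinearMap.comp_apply, TensorProduct.map_tmul]
    generalize YDModule.coaction (K := K) (H := MonoidAlgebra K G) a = y
    generalize YDModule.coaction (K := K) (H := MonoidAlgebra K G) b = z
    induction y with
    | zero => simp
    | add x y hx hy => simp_all only [map_add, TensorProduct.add_tmul]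
    | tmul h v =>
      induction z with
      | zero => simp
      | add x y hx hy => simp_all only [map_add, TensorProduct.tmul_add]
      | tmul h' v' => simp [hmul, TensorProduct.smul_tmul', smul_smul, mul_comm]

lemma psi_mul (γ : G →* Kˣ) (a b : A) : psi A γ (a * b) = psi A γ a * psi A γ b := by
  have h := LinearMap.congr_fun (YDHopfAlgebra.coaction_mul (K := K) (H := MonoidAlgebra K G)
    (A := A)) (a ⊗ₜ b)
  have h2 := congr(TensorProduct.lid K A (LinearMap.rTensor A (extendChar γ) $h))
  simp only [LinearMap.comp_apply, lid_rTensor_lTensor, contract_codiagonalCoaction,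
    TensorProduct.map_tmul, LinearMap.mul'_apply] at h2
  exact h2

lemma comul_psi (γ : G →* Kˣ) (a : A) :
    Coalgebra.comul (R := K) (psi A γ a) =
      TensorProduct.map (psi A γ) (psi A γ) (Coalgebra.comul (R := K) a) := by
  have h := LinearMap.congr_fun (YDHopfAlgebra.coaction_comul (K := K) (H := MonoidAlgebra K G)
    (A := A)) a
  have h2 := congr(TensorProduct.lid K _ (LinearMap.rTensor _ (extendChar γ) $h))
  simp only [LinearMap.comp_apply, lid_rTensor_lTensor, contract_codiagonalCoaction] at h2
  exact h2

lemma psi_map_one (γ : G →* Kˣ) : psi A γ 1 = 1 := by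
  simp [psi, YDHopfAlgebra.coaction_one, MonoidAlgebra.one_def, extendChar_single]

lemma braidedMul_tmul [Fintype G] (a a' b b' : A) :
    braidedMul K (MonoidAlgebra K G) A ((a ⊗ₜ a') ⊗ₜ (b ⊗ₜ b')) =
      ∑ k : G, (a * phi K A k b) ⊗ₜ[K] (component K A k a' * b') := by
  simp [braidedMul, quasisymmetry, coaction_eq_sum, TensorProduct.sum_tmul, TensorProduct.tmul_sum,
    actionMap, phi_apply]

end HopfAlgebra

/-! ### Finite-dimensionality -/

section Finite

variable {K : Type*} [Field K] {V W : Type*} [AddCommGroup V] [Module K V]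
  [AddCommGroup W] [Module K W]

lemma exists_fg_contraction_mem (x : V ⊗[K] W) :
    ∃ F : Submodule K W, F.FG ∧
      ∀ f : Module.Dual K V, TensorProduct.lid K W (LinearMap.rTensor W f x) ∈ F := by
  induction x with
  | zero => exact ⟨⊥, Submodule.fg_bot, fun f => by simp⟩
  | add x y hx hy =>
    obtain ⟨F, hF, hx⟩ := hx
    obtain ⟨F', hF', hy⟩ := hy
    refine ⟨F ⊔ F', hF.sup hF', fun f => ?_⟩
    simp only [map_add]
    exact Submodule.add_mem_sup (hx f) (hy f)
  | tmul v w =>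
    refine ⟨K ∙ w, Submodule.fg_span_singleton w, fun f => ?_⟩
    simpa using Submodule.smul_mem _ _ (Submodule.mem_span_singleton_self w)

/-- The kernel of `ε` has a complementary ideal; `t` is the component of `1` in it. -/
lemma exists_integral (A : Type*) [CommRing A] [Algebra K A] [IsSemisimpleRing A]
    (ε : A →ₐ[K] K) : ∃ t : A, ε t = 1 ∧ ∀ a, a * t = ε a • t := by
  obtain ⟨I, hI⟩ := exists_isCompl (RingHom.ker ε : Ideal A)
  have h1 : (1 : A) ∈ (RingHom.ker ε : Ideal A) ⊔ I := by rw [hI.sup_eq_top]; trivial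
  obtain ⟨k, hk, t, ht, hkt⟩ := Submodule.mem_sup.1 h1
  have hεt : ε t = 1 := by
    have := congr(ε $hkt)
    rw [RingHom.mem_ker] at hk
    simpa [hk] using this
  refine ⟨t, hεt, fun a => sub_eq_zero.1 ?_⟩
  rw [← Submodule.mem_bot A, ← hI.inf_eq_bot]
  refine ⟨?_, ?_⟩
  · rw [SetLike.mem_coe, RingHom.mem_ker]
    simp [hεt]
  · refine I.sub_mem (I.mul_mem_left _ ht) ?_
    rw [Algebra.smul_def]
    exact I.mul_mem_left _ ht

end Finite

section FiniteDimensional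

variable {K G A : Type*} [Field K] [CommGroup G] [Fintype G] [CommRing A] [Algebra K A]
  [Coalgebra K A] [Module (MonoidAlgebra K G) A] [IsScalarTower K (MonoidAlgebra K G) A]
  [YDHopfAlgebra K (MonoidAlgebra K G) A]

lemma braidedMul_one_tmul (a : A) (x : A ⊗[K] A) :
    braidedMul K (MonoidAlgebra K G) A ((1 ⊗ₜ a) ⊗ₜ x) =
      ∑ k : G, TensorProduct.map (phi K A k) (LinearMap.mul K A (component K A k a)) x := by
  induction x with
  | zero => simp
  | add x y hx hy => simp only [TensorProduct.tmul_add, map_add, Finset.sum_add_distrib, hx, hy]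
  | tmul b c => simp [braidedMul_tmul]

lemma braidedMul_mul_tmul (b c d : A) (x : A ⊗[K] A) :
    braidedMul K (MonoidAlgebra K G) A (((b * c) ⊗ₜ d) ⊗ₜ x) =
      LinearMap.rTensor A (LinearMap.mul K A b)
        (braidedMul K (MonoidAlgebra K G) A ((c ⊗ₜ d) ⊗ₜ x)) := by
  induction x with
  | zero => simp
  | add x y hx hy => simp only [TensorProduct.tmul_add, map_add, hx, hy]
  | tmul b' c' => simp [braidedMul_tmul, mul_assoc]

variable (K G) in
/-- For an integral `t`, the equation `(1 ⊗ a)Δ(t) = (S(a) ⊗ 1)Δ(t)` in `A ⊗̂ A`. It follows from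
`1 ⊗ a = (S(a₍₁₎) ⊗ 1)Δ(a₍₂₎)`; the sum on the left is the braided product with `1 ⊗ a`. -/
lemma sum_map_comul_integral {t : A}
    (ht : ∀ a, a * t = Coalgebra.counit (R := K) a • t) (a : A) :
    ∑ k : G, TensorProduct.map (phi K A k) (LinearMap.mul K A (component K A k a))
        (Coalgebra.comul (R := K) t) =
      LinearMap.rTensor A
        (LinearMap.mul K A (YDHopfAlgebra.antipode (K := K) (H := MonoidAlgebra K G) a))
        (Coalgebra.comul (R := K) t) := by
  set S : A →ₗ[K] A := YDHopfAlgebra.antipode (K := K) (H := MonoidAlgebra K G) with hS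
  set B := braidedMul K (MonoidAlgebra K G) A
  -- `Θ` is the map `b ⊗ y ↦ (S(b) ⊗ 1) y Δ(t)`
  let Θ : A ⊗[K] (A ⊗[K] A) →ₗ[K] A ⊗[K] A := TensorProduct.lift
    ((LinearMap.lcomp K _ (B ∘ₗ (TensorProduct.mk K _ _).flip (Coalgebra.comul (R := K) t))) ∘ₗ
      LinearMap.rTensorHom A ∘ₗ LinearMap.mul K A ∘ₗ S)
  have hΘ (b : A) (y : A ⊗[K] A) : Θ (b ⊗ₜ y) =
      LinearMap.rTensor A (LinearMap.mul K A (S b)) (B (y ⊗ₜ Coalgebra.comul (R := K) t)) := by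
    simp [Θ]
  have h1 (z : (A ⊗[K] A) ⊗[K] A) : Θ (TensorProduct.assoc K A A A z) =
      B (LinearMap.rTensor A (LinearMap.mul' K A ∘ₗ LinearMap.rTensor A S) z ⊗ₜ
        Coalgebra.comul (R := K) t) := by
    induction z with
    | zero => simp
    | add x y hx hy => simp only [TensorProduct.add_tmul, map_add, hx, hy]
    | tmul z d =>
      induction z with
      | zero => simp
      | add x y hx hy => simp only [TensorProduct.add_tmul, map_add, hx, hy]
      | tmul b c => simp [hΘ, B, braidedMul_mul_tmul]
  have h2 (x : A ⊗[K] A) : Θ (LinearMap.lTensor A (Coalgebra.comul (R := K)) x) =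
      LinearMap.rTensor A (LinearMap.mul K A (S (TensorProduct.rid K A
        (LinearMap.lTensor A (Coalgebra.counit (R := K)) x)))) (Coalgebra.comul (R := K) t) := by
    induction x with
    | zero => simp
    | add x y hx hy => simp only [map_add, hx, hy, LinearMap.rTensor_add, LinearMap.add_apply]
    | tmul b c =>
      rw [LinearMap.lTensor_tmul, hΘ, ← YDHopfAlgebra.comul_mul, ht]
      simp [LinearMap.rTensor_smul]
  have h3 := h2 (Coalgebra.comul (R := K) a)
  rw [← Coalgebra.coassoc_apply, h1, ← LinearMap.comp_apply (LinearMap.rTensor A _),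
    ← LinearMap.rTensor_comp, LinearMap.comp_assoc, hS,
    YDHopfAlgebra.mul_antipode_rTensor_comul, LinearMap.rTensor_comp, LinearMap.comp_apply,
    Coalgebra.rTensor_counit_comul, Coalgebra.lTensor_counit_comul] at h3
  simpa [B, braidedMul_one_tmul] using h3

/-- A semisimple Yetter-Drinfel'd Hopf algebra is finite-dimensional: if `t` is an integral with
`ε(t) = 1`, then the right tensor factors of `Δ(t)` span an ideal that contains
`S(t₍₁₎) t₍₂₎ = 1`. -/
theorem finite_of_isSemisimpleRing (K G A : Type*) [Field K] [CommGroup G] [Fintype G] [CommRing A]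
    [Algebra K A] [IsSemisimpleRing A] [Coalgebra K A] [Module (MonoidAlgebra K G) A]
    [IsScalarTower K (MonoidAlgebra K G) A] [YDHopfAlgebra K (MonoidAlgebra K G) A] :
    Module.Finite K A := by
  classical
  let ε : A →ₐ[K] K := AlgHom.ofLinearMap Coalgebra.counit
    (YDHopfAlgebra.counit_one (H := MonoidAlgebra K G))
    (YDHopfAlgebra.counit_mul (H := MonoidAlgebra K G))
  obtain ⟨t, ht1, ht⟩ := exists_integral A ε
  replace ht1 : Coalgebra.counit (R := K) t = 1 := ht1
  replace ht : ∀ a, a * t = Coalgebra.counit (R := K) a • t := ht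
  let C : Module.Dual K A →ₗ[K] A := (TensorProduct.lid K A).toLinearMap ∘ₗ
    LinearMap.applyₗ (Coalgebra.comul (R := K) t) ∘ₗ LinearMap.rTensorHom A
  have hC (f : Module.Dual K A) :
    C f = TensorProduct.lid K A (LinearMap.rTensor A f (Coalgebra.comul (R := K) t)) := rfl
  set S : A →ₗ[K] A := YDHopfAlgebra.antipode (K := K) (H := MonoidAlgebra K G) with hS
  have hcomp (k : G) (a : A) (f : Module.Dual K A) :
      component K A k a * C f ∈ LinearMap.range C := by
    have h := sum_map_comul_integral K G ht (component K A k a)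
    simp only [component_component] at h
    rw [Finset.sum_eq_single k (fun l _ hl => by simp [hl.symm]) (by simp), if_pos rfl] at h
    refine ⟨f ∘ₗ phi K A k⁻¹ ∘ₗ LinearMap.mul K A (S (component K A k a)), ?_⟩
    rw [hC, hC, ← LinearMap.comp_assoc, LinearMap.rTensor_comp, LinearMap.comp_apply, ← h]
    generalize Coalgebra.comul (R := K) t = x
    induction x with
    | zero => simp
    | add x y hx hy => simp only [map_add, hx, hy, mul_add]
    | tmul b c => simp [phi_inv_apply_phi]
  have hideal (a : A) {y : A} (hy : y ∈ LinearMap.range C) : a * y ∈ LinearMap.range C := by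
    obtain ⟨f, rfl⟩ := hy
    rw [← sum_component (K := K) (G := G) a, Finset.sum_mul]
    exact Submodule.sum_mem _ fun k _ => hcomp k a f
  have hone : (1 : A) ∈ LinearMap.range C := by
    have h := LinearMap.congr_fun
      (YDHopfAlgebra.mul_antipode_rTensor_comul (K := K) (H := MonoidAlgebra K G) (A := A)) t
    simp only [LinearMap.comp_apply, ht1, ← hS] at h
    rw [show Algebra.linearMap K A 1 = 1 by simp] at h
    rw [← h]
    let b := Module.Basis.ofVectorSpace K A
    have hx : Coalgebra.comul (R := K) t = _ :=
      ((TensorProduct.equivFinsuppOfBasisLeft b).symm_apply_apply _).symm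
    rw [TensorProduct.equivFinsuppOfBasisLeft_symm_apply] at hx
    rw [hx, Finsupp.sum, map_sum, map_sum]
    refine Submodule.sum_mem _ fun i _ => ?_
    rw [LinearMap.rTensor_tmul, LinearMap.mul'_apply, TensorProduct.equivFinsuppOfBasisLeft_apply]
    exact hideal _ ⟨b.coord i, rfl⟩
  obtain ⟨F, hF, hCF⟩ := exists_fg_contraction_mem (Coalgebra.comul (R := K) t)
  have htop : F = ⊤ := by
    refine eq_top_iff.2 fun a _ => ?_
    obtain ⟨f, hf⟩ := hideal a hone
    rw [← mul_one a, ← hf]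
    exact hCF f
  exact ⟨htop ▸ hF⟩

end FiniteDimensional

/-! ### Characters and primitive idempotents of a commutative semisimple algebra -/

section Split

variable {K A : Type*} [Field K] [CommRing A] [Algebra K A]

/-- Since there are only finitely many characters, products of elements that separate `χ` from one
other character separate it from all of them. -/
lemma exists_dual_idempotent [Module.Finite K A] (χ : A →ₐ[K] K) :
    ∃ e : A, χ e = 1 ∧ ∀ ω : A →ₐ[K] K, ω ≠ χ → ω e = 0 := by
  classical
  have := Fintype.ofFinite (A →ₐ[K] K)
  have h (ω : A →ₐ[K] K) : ∃ b : A, χ b = 1 ∧ (ω ≠ χ → ω b = 0) := by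
    by_cases hω : ω = χ
    · exact ⟨1, map_one _, fun h => absurd hω h⟩
    obtain ⟨x, hx⟩ : ∃ x, ω x ≠ χ x := by
      by_contra! h
      exact hω (AlgHom.ext h)
    have hx' : χ x - ω x ≠ 0 := sub_ne_zero.2 (Ne.symm hx)
    refine ⟨(χ x - ω x)⁻¹ • (x - algebraMap K A (ω x)), ?_, fun _ => ?_⟩ <;> simp [hx']
  choose b hb hb' using h
  refine ⟨∏ ω, b ω, by simp [hb], fun ω hω => ?_⟩
  rw [map_prod]
  exact Finset.prod_eq_zero (Finset.mem_univ ω) (hb' ω hω)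

variable [Module.Finite K A]

/-- The element of `A` on which `χ` is `1` and all other characters are `0`. -/
def dualIdempotent (χ : A →ₐ[K] K) : A := (exists_dual_idempotent χ).choose

open Classical in
lemma apply_dualIdempotent (ω χ : A →ₐ[K] K) :
    ω (dualIdempotent χ) = if ω = χ then 1 else 0 := by
  split_ifs with h
  · rw [h]
    exact (exists_dual_idempotent χ).choose_spec.1
  · exact (exists_dual_idempotent χ).choose_spec.2 ω h

lemma dualIdempotent_injective :
    Function.Injective (dualIdempotent : (A →ₐ[K] K) → A) := fun χ ω h => by
  classical
  have h1 := apply_dualIdempotent χ ω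
  rw [← h, apply_dualIdempotent, if_pos rfl] at h1
  by_contra h2
  simp [h2] at h1

variable [IsAlgClosed K] [IsSemisimpleRing A]

/-- The characters of a commutative semisimple algebra separate points: the Jacobson radical
vanishes, and all residue fields are equal to `K`. -/
lemma eq_of_forall_character {a b : A} (h : ∀ χ : A →ₐ[K] K, χ a = χ b) : a = b := by
  rw [← sub_eq_zero]
  have hj : a - b ∈ Ring.jacobson A := by
    rw [Ring.jacobson_eq_sInf_isMaximal, Submodule.mem_sInf]
    intro (I : Ideal A) hI
    have : I.IsMaximal := hI
    let _ := Ideal.Quotient.field I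
    have hbij : Function.Bijective (algebraMap K (A ⧸ I)) :=
      IsAlgClosed.algebraMap_bijective_of_isIntegral
    let e := (AlgEquiv.ofBijective (Algebra.ofId K (A ⧸ I)) hbij).symm
    have h2 := h (e.toAlgHom.comp (Ideal.Quotient.mkₐ K I))
    have h3 : Ideal.Quotient.mk I a = Ideal.Quotient.mk I b := e.injective h2
    exact (Ideal.Quotient.eq).1 h3
  rwa [IsSemisimpleRing.jacobson_eq_bot, Submodule.mem_bot] at hj

lemma mul_dualIdempotent (a : A) (χ : A →ₐ[K] K) :
    a * dualIdempotent χ = χ a • dualIdempotent χ := by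
  classical
  refine eq_of_forall_character (K := K) fun ω => ?_
  simp only [map_mul, map_smul, apply_dualIdempotent]
  split_ifs with h <;> simp [h]

lemma dualIdempotent_mul_dualIdempotent [DecidableEq (A →ₐ[K] K)] (χ ω : A →ₐ[K] K) :
    dualIdempotent χ * dualIdempotent ω = if χ = ω then dualIdempotent ω else 0 := by
  rw [mul_dualIdempotent, apply_dualIdempotent]
  by_cases h : χ = ω
  · simp [h]
  · simp [h, Ne.symm h]

lemma eq_sum_dualIdempotent [Fintype (A →ₐ[K] K)] (a : A) :
    a = ∑ χ : A →ₐ[K] K, χ a • dualIdempotent χ := by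
  classical
  exact eq_of_forall_character (K := K) fun ω => by simp [apply_dualIdempotent]

lemma isPrimitiveIdempotent_dualIdempotent (χ : A →ₐ[K] K) :
    IsPrimitiveIdempotent (dualIdempotent χ) := by
  classical
  refine ⟨?_, fun h => ?_, fun f f' hf hf' hff' _ hsum => ?_⟩
  · rw [IsIdempotentElem, dualIdempotent_mul_dualIdempotent, if_pos rfl]
  · simpa [h] using apply_dualIdempotent χ χ
  · have key (f f' : A) (hff' : f * f' = 0) (hf : IsIdempotentElem f)
        (hsum : dualIdempotent χ = f + f') (h0 : χ f = 0) : f = 0 := by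
      have h1 : f * dualIdempotent χ = f := by rw [hsum, mul_add, hff', hf.eq, add_zero]
      rw [← h1, mul_dualIdempotent, h0, zero_smul]
    have h2 : χ f * χ f' = 0 := by rw [← map_mul, hff', map_zero]
    rcases mul_eq_zero.1 h2 with h | h
    · exact .inl (key f f' hff' hf hsum h)
    · exact .inr (key f' f (by rwa [mul_comm]) hf' (by rwa [add_comm]) h)

lemma IsPrimitiveIdempotent.exists_eq_dualIdempotent {e : A} (he : IsPrimitiveIdempotent e) :
    ∃ χ : A →ₐ[K] K, e = dualIdempotent χ := by
  obtain ⟨χ, hχ⟩ : ∃ χ : A →ₐ[K] K, χ e ≠ 0 := by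
    by_contra! h
    exact he.2.1 (eq_of_forall_character (K := K) fun χ => by simp [h])
  have hχ1 : χ e = 1 := (IsIdempotentElem.iff_eq_zero_or_one.1 (he.1.map χ)).resolve_left hχ
  have hmul : e * dualIdempotent χ = dualIdempotent χ := by
    rw [mul_dualIdempotent, hχ1, one_smul]
  have hid := (isPrimitiveIdempotent_dualIdempotent χ).1
  have hsub : IsIdempotentElem (e - dualIdempotent χ) := by
    rw [IsIdempotentElem, sub_mul, mul_sub, mul_sub, he.1.eq, hmul, mul_comm _ e, hmul, hid.eq,
      sub_self, sub_zero]
  rcases he.2.2 (dualIdempotent χ) (e - dualIdempotent χ) hid hsub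
    (by rw [mul_sub, mul_comm _ e, hmul, hid.eq, sub_self])
    (by rw [sub_mul, hmul, hid.eq, sub_self]) (by ring) with h | h
  · exact absurd h (isPrimitiveIdempotent_dualIdempotent χ).2.1
  · exact ⟨χ, sub_eq_zero.1 h⟩

lemma isCharacterOf_dualIdempotent_iff {χ ω : A →ₐ[K] K} :
    IsCharacterOf K (dualIdempotent χ) ω ↔ ω = χ := by
  classical
  refine ⟨fun h => ?_, ?_⟩
  · have := h.1
    rw [apply_dualIdempotent] at this
    by_contra h'
    simp [h'] at this
  · rintro rfl
    refine ⟨by simp [apply_dualIdempotent], fun e he hne => ?_⟩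
    obtain ⟨χ, rfl⟩ := he.exists_eq_dualIdempotent (K := K)
    rw [apply_dualIdempotent, if_neg]
    rintro rfl
    exact hne rfl

lemma eta_dualIdempotent (χ : A →ₐ[K] K) : eta K (dualIdempotent χ) = χ.toLinearMap := by
  have h : ∃ η : A →ₐ[K] K, IsCharacterOf K (dualIdempotent χ) η :=
    ⟨χ, isCharacterOf_dualIdempotent_iff.2 rfl⟩
  rw [eta, dif_pos h, isCharacterOf_dualIdempotent_iff.1 h.choose_spec]

/-- An automorphism of `A` permutes the primitive idempotents in the way in which it permutes the
characters. -/
lemma map_dualIdempotent_comp (θ : A ≃ₐ[K] A) (χ : A →ₐ[K] K) :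
    θ (dualIdempotent (χ.comp θ.toAlgHom)) = dualIdempotent χ := by
  classical
  refine eq_of_forall_character (K := K) fun ω => ?_
  have h := apply_dualIdempotent (ω.comp θ.toAlgHom) (χ.comp θ.toAlgHom)
  rw [apply_dualIdempotent]
  refine h.trans ?_
  congr 1
  refine propext ⟨fun h => AlgHom.ext fun a => ?_, fun h => by rw [h]⟩
  have := DFunLike.congr_fun h (θ.symm a)
  simpa using this

/-- If an automorphism maps a set of primitive idempotents to itself, its transpose maps the
corresponding set of characters to itself: by finiteness, the automorphism permutes the
idempotents. -/
lemma comp_mem_of_mapsTo (θ : A ≃ₐ[K] A) {N : Set (A →ₐ[K] K)}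
    (h : Set.MapsTo θ (dualIdempotent '' N) (dualIdempotent '' N)) {χ : A →ₐ[K] K} (hχ : χ ∈ N) :
    χ.comp θ.toAlgHom ∈ N := by
  have himage := Set.eq_of_subset_of_ncard_le h.image_subset
    (Set.ncard_image_of_injective _ θ.injective).ge
  obtain ⟨_, ⟨ω, hω, rfl⟩, hωχ⟩ := himage.ge ⟨χ, hχ, rfl⟩
  rw [← map_dualIdempotent_comp θ χ, θ.injective.eq_iff, dualIdempotent_injective.eq_iff] at hωχ
  rwa [← hωχ]

/-- A space of linear forms that is stable under translations is spanned by characters, namely by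
those whose idempotent it does not annihilate. -/
lemma eq_span_characters {W : Submodule K (Module.Dual K A)}
    (hW : ∀ w ∈ W, ∀ a : A, w ∘ₗ LinearMap.mul K A a ∈ W) :
    W = Submodule.span K
      (AlgHom.toLinearMap '' {χ : A →ₐ[K] K | ∃ w ∈ W, w (dualIdempotent χ) ≠ 0}) := by
  have := Fintype.ofFinite (A →ₐ[K] K)
  refine le_antisymm (fun w hw => ?_) (Submodule.span_le.2 ?_)
  · have h : w = ∑ χ : A →ₐ[K] K, w (dualIdempotent χ) • χ.toLinearMap := by
      refine LinearMap.ext fun a => ?_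
      conv_lhs => rw [eq_sum_dualIdempotent (K := K) a]
      simp [mul_comm]
    rw [h]
    refine Submodule.sum_mem _ fun χ _ => ?_
    by_cases h0 : w (dualIdempotent χ) = 0
    · simp [h0]
    · exact Submodule.smul_mem _ _ (Submodule.subset_span ⟨χ, ⟨w, hw, h0⟩, rfl⟩)
  · rintro _ ⟨χ, ⟨w, hw, h0⟩, rfl⟩
    have h : χ.toLinearMap =
        (w (dualIdempotent χ))⁻¹ • (w ∘ₗ LinearMap.mul K A (dualIdempotent χ)) := by
      refine LinearMap.ext fun a => ?_
      simp [mul_comm _ a, mul_dualIdempotent]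
      field_simp
    rw [h]
    exact W.smul_mem _ (hW w hw _)

end Split

/-! ### The convolution product of characters -/

section Convolution

variable {K G A : Type*} [Field K] [CommGroup G] [CommRing A] [Algebra K A]
  [Coalgebra K A] [Module (MonoidAlgebra K G) A] [IsScalarTower K (MonoidAlgebra K G) A]
  [YDHopfAlgebra K (MonoidAlgebra K G) A]

variable (K A) in
/-- The algebra automorphism `φ_g`. -/
def phiEquiv (g : G) : A ≃ₐ[K] A :=
  AlgEquiv.ofLinearEquiv
    (LinearEquiv.ofLinearMap (phi K A g) (phi K A g⁻¹) (LinearMap.ext fun a => phi_apply_phi_inv g a)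
      (LinearMap.ext fun a => phi_inv_apply_phi g a))
    (phi_map_one g) (phi_mul g)

/-- The character `χ ∘ φ_g`. -/
def phiDual (g : G) (χ : A →ₐ[K] K) : A →ₐ[K] K := χ.comp (phiEquiv K A g).toAlgHom

lemma phiDual_apply (g : G) (χ : A →ₐ[K] K) (a : A) : phiDual g χ a = χ (phi K A g a) := rfl

lemma phiDual_phiDual (g h : G) (χ : A →ₐ[K] K) : phiDual h (phiDual g χ) = phiDual (g * h) χ :=
  AlgHom.ext fun a => by simp only [phiDual_apply, phi_mul_apply]

lemma phiDual_one (χ : A →ₐ[K] K) : phiDual (1 : G) χ = χ :=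
  AlgHom.ext fun a => by simp only [phiDual_apply, phi_one_apply]

variable [Fintype G]

variable (A) in
/-- The algebra automorphism `ψ_γ`. -/
def psiEquiv (γ : G →* Kˣ) : A ≃ₐ[K] A :=
  AlgEquiv.ofLinearEquiv
    (LinearEquiv.ofLinearMap (psi A γ) (psi A γ⁻¹) (LinearMap.ext fun a => psi_apply_psi_inv γ a)
      (LinearMap.ext fun a => psi_inv_apply_psi γ a))
    (psi_map_one γ) (psi_mul γ)

/-- The character `χ ∘ ψ_γ`. -/
def psiDual (γ : G →* Kˣ) (χ : A →ₐ[K] K) : A →ₐ[K] K := χ.comp (psiEquiv A γ).toAlgHom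

lemma psiDual_apply (γ : G →* Kˣ) (χ : A →ₐ[K] K) (a : A) :
    psiDual γ χ a = χ (psi A γ a) := rfl

lemma psiDual_psiDual (γ δ : G →* Kˣ) (χ : A →ₐ[K] K) :
    psiDual δ (psiDual γ χ) = psiDual (γ * δ) χ :=
  AlgHom.ext fun a => by simp only [psiDual_apply, psi_mul_apply]

lemma psiDual_one (χ : A →ₐ[K] K) : psiDual (1 : G →* Kˣ) χ = χ :=
  AlgHom.ext fun a => by simp only [psiDual_apply, psi_one_apply]

end Convolution

section DualMul

variable {K A : Type*} [Field K] [CommRing A] [Algebra K A] [Coalgebra K A]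

lemma dualMul_apply (f f' : Module.Dual K A) (a : A) :
    dualMul f f' a =
      LinearMap.mul' K K (TensorProduct.map f f' (Coalgebra.comul (R := K) a)) := rfl

lemma dualMul_comp {θ : A →ₗ[K] A}
    (hθ : ∀ a, Coalgebra.comul (R := K) (θ a) =
      TensorProduct.map θ θ (Coalgebra.comul (R := K) a)) (f f' : Module.Dual K A) :
    dualMul f f' ∘ₗ θ = dualMul (f ∘ₗ θ) (f' ∘ₗ θ) := by
  refine LinearMap.ext fun a => ?_
  rw [LinearMap.comp_apply, dualMul_apply, dualMul_apply, hθ, TensorProduct.map_comp,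
    LinearMap.comp_apply]

/-- The product `φφ'` of linear forms, as a linear function of `φ`. -/
def dualMulRight (f' : Module.Dual K A) : Module.Dual K A →ₗ[K] Module.Dual K A where
  toFun f := dualMul f f'
  map_add' f g := by
    refine LinearMap.ext fun a => ?_
    simp [dualMul_apply, TensorProduct.map_add_left]
  map_smul' c f := by
    refine LinearMap.ext fun a => ?_
    simp [dualMul_apply, TensorProduct.map_smul_left]

/-- Multiplication by a character `χ` is injective, since `χ ∘ S`, with `S` the antipode, is a convolution inverse
of `χ`. -/
lemma dualMulRight_injective {S : A →ₗ[K] A}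
    (hS : LinearMap.mul' K A ∘ₗ LinearMap.lTensor A S ∘ₗ Coalgebra.comul =
      Algebra.linearMap K A ∘ₗ Coalgebra.counit) (χ : A →ₐ[K] K) :
    Function.Injective (dualMulRight χ.toLinearMap) := by
  have hinv : WithConv.toConv χ.toLinearMap * WithConv.toConv (χ.toLinearMap ∘ₗ S) = 1 := by
    refine WithConv.ofConv_injective (LinearMap.ext fun a => ?_)
    have h := congr(χ $(LinearMap.congr_fun hS a))
    have h2 (x : A ⊗[K] A) : LinearMap.mul' K K
        (TensorProduct.map χ.toLinearMap (χ.toLinearMap ∘ₗ S) x) =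
          χ (LinearMap.mul' K A (LinearMap.lTensor A S x)) := by
      induction x with
      | zero => simp
      | add x y hx hy => simp only [map_add, hx, hy]
      | tmul b c => simp
    refine (h2 _).trans (h.trans ?_)
    simp [LinearMap.convOne_def]
  intro f f' hff'
  have h := congr(WithConv.toConv ($hff') * WithConv.toConv (χ.toLinearMap ∘ₗ S))
  have h2 (f : Module.Dual K A) : WithConv.toConv (dualMulRight χ.toLinearMap f) *
      WithConv.toConv (χ.toLinearMap ∘ₗ S) = WithConv.toConv f := by
    change WithConv.toConv f * WithConv.toConv χ.toLinearMap * _ = _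
    rw [mul_assoc, hinv, mul_one]
  rw [h2, h2] at h
  exact WithConv.toConv_injective h

end DualMul

section Formulas

variable {K G A : Type*} [Field K] [CommGroup G] [CommRing A] [Algebra K A]
  [Coalgebra K A] [Module (MonoidAlgebra K G) A] [IsScalarTower K (MonoidAlgebra K G) A]
  [YDHopfAlgebra K (MonoidAlgebra K G) A]

variable [Fintype G]

/-- The coproduct of a product of characters: `χχ'` corresponds to
`∑ₖ χ(χ' ∘ pₖ) ⊗ (χ ∘ φₖ)χ'`, where `pₖ` is the projection onto the component of degree `k`. -/
lemma dualMul_apply_mul (χ χ' : A →ₐ[K] K) (a b : A) :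
    dualMul χ.toLinearMap χ'.toLinearMap (a * b) =
      ∑ k : G, dualMul χ.toLinearMap (χ'.toLinearMap ∘ₗ component K A k) a *
        dualMul (phiDual k χ).toLinearMap χ'.toLinearMap b := by
  simp only [dualMul_apply]
  rw [YDHopfAlgebra.comul_mul (H := MonoidAlgebra K G)]
  generalize Coalgebra.comul (R := K) a = x
  generalize Coalgebra.comul (R := K) b = y
  induction x with
  | zero => simp
  | add x y hx hy => simp only [TensorProduct.add_tmul, map_add, hx, hy, add_mul,
      Finset.sum_add_distrib]
  | tmul a a' =>
    induction y with
    | zero => simp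
    | add x y hx hy => simp only [TensorProduct.tmul_add, map_add, hx, hy, mul_add,
        Finset.sum_add_distrib]
    | tmul b b' =>
      simp only [braidedMul_tmul, map_sum, TensorProduct.map_tmul, LinearMap.mul'_apply,
        LinearMap.comp_apply, AlgHom.toLinearMap_apply, map_mul, phiDual_apply]
      exact Finset.sum_congr rfl fun k _ => by ring

end Formulas

/-! ### The products of two orbits of characters -/

section Perp

variable {K G : Type*} [Field K] [CommGroup G]

lemma mul_mem_perpChars {Q : Set (G →* Kˣ)} {g h : G} (hg : g ∈ perpChars Q)
    (hh : h ∈ perpChars Q) : g * h ∈ perpChars Q := fun γ hγ => by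
  rw [map_mul, hg γ hγ, hh γ hγ, mul_one]

lemma inv_mem_perpChars {Q : Set (G →* Kˣ)} {g : G} (hg : g ∈ perpChars Q) :
    g⁻¹ ∈ perpChars Q := fun γ hγ => by
  rw [map_inv, hg γ hγ, inv_one]

lemma mul_mem_perpGroup {T : Set G} {γ δ : G →* Kˣ} (hγ : γ ∈ perpGroup K T)
    (hδ : δ ∈ perpGroup K T) : γ * δ ∈ perpGroup K T := fun g hg => by
  rw [MonoidHom.mul_apply, hγ g hg, hδ g hg, mul_one]

lemma inv_mem_perpGroup {T : Set G} {γ : G →* Kˣ} (hγ : γ ∈ perpGroup K T) :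
    γ⁻¹ ∈ perpGroup K T := fun g hg => by
  rw [MonoidHom.inv_apply, hγ g hg, inv_one]

end Perp

section OrbitDefinitions

variable {K G A : Type*} [Field K] [CommGroup G] [CommRing A] [Algebra K A]
  [Coalgebra K A] [Module (MonoidAlgebra K G) A] [IsScalarTower K (MonoidAlgebra K G) A]
  [YDHopfAlgebra K (MonoidAlgebra K G) A]

section Left

variable [Module.Finite K A]

variable (G) in
/-- The characters `η_f` with `f ∈ O`, where `η = η_e` and `η' = η_{e'}`. -/
def leftOrbit (η η' : A →ₐ[K] K) : Set (A →ₐ[K] K) :=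
  (fun g : G => phiDual g η) '' perpChars (isotropy K G (dualIdempotent η'))

lemma self_mem_leftOrbit (η η' : A →ₐ[K] K) : η ∈ leftOrbit G η η' :=
  ⟨1, fun γ _ => map_one γ, phiDual_one η⟩

lemma phiDual_mem_leftOrbit {η η' χ : A →ₐ[K] K} {g : G}
    (hg : g ∈ perpChars (isotropy K G (dualIdempotent η'))) (hχ : χ ∈ leftOrbit G η η') :
    phiDual g χ ∈ leftOrbit G η η' := by
  obtain ⟨h, hh, rfl⟩ := hχ
  exact ⟨h * g, mul_mem_perpChars hh hg, (phiDual_phiDual h g η).symm⟩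

end Left

lemma phi_dualIdempotent [Module.Finite K A] [IsAlgClosed K] [IsSemisimpleRing A] (g : G)
    (χ : A →ₐ[K] K) :
    phi K A g (dualIdempotent χ) = dualIdempotent (phiDual g⁻¹ χ) := by
  have h := map_dualIdempotent_comp (phiEquiv K A g) (phiDual g⁻¹ χ)
  change phi K A g (dualIdempotent (phiDual g (phiDual g⁻¹ χ))) = _ at h
  rwa [phiDual_phiDual, inv_mul_cancel, phiDual_one] at h

variable [Fintype G]

/-- The product formula for `(η ∘ φ_g)(η' ∘ ψ_γ)`, rescaled by `γ(g)`: the coefficient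
`(η ∘ φ_g)(η' ∘ pₖ)` no longer depends on `γ`. -/
lemma rescaled_dualMul_apply_mul (η η' : A →ₐ[K] K) (g : G) (γ : G →* Kˣ) (a b : A) :
    (γ g : K) * dualMul (phiDual g η).toLinearMap (psiDual γ η').toLinearMap (a * b) =
      ∑ k : G, dualMul (phiDual g η).toLinearMap (η'.toLinearMap ∘ₗ component K A k) a *
        ((γ (g * k) : Kˣ) *
          dualMul (phiDual (g * k) η).toLinearMap (psiDual γ η').toLinearMap b) := by
  have h (k : G) : (psiDual γ η').toLinearMap ∘ₗ component K A k =
      (γ k : K) • (η'.toLinearMap ∘ₗ component K A k) :=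
    LinearMap.ext fun a => by simp [psiDual_apply, psi_component]
  have h2 (f f' : Module.Dual K A) (c : K) (a : A) :
      dualMul f (c • f') a = c * dualMul f f' a := by
    simp [dualMul_apply, TensorProduct.map_smul_right]
  rw [dualMul_apply_mul (G := G), Finset.mul_sum]
  refine Finset.sum_congr rfl fun k _ => ?_
  rw [h, h2, phiDual_phiDual, map_mul, Units.val_mul]
  ring

variable [Module.Finite K A]

variable (G) in
/-- The characters `η_{f'}` with `f' ∈ O'`, where `η = η_e` and `η' = η_{e'}`. -/
def rightOrbit (η η' : A →ₐ[K] K) : Set (A →ₐ[K] K) :=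
  (fun γ : G →* Kˣ => psiDual γ η') '' perpGroup K (inertia K G (dualIdempotent η))

lemma self_mem_rightOrbit (η η' : A →ₐ[K] K) : η' ∈ rightOrbit G η η' :=
  ⟨1, fun _ _ => rfl, psiDual_one η'⟩

lemma psiDual_mem_rightOrbit {η η' χ : A →ₐ[K] K} {γ : G →* Kˣ}
    (hγ : γ ∈ perpGroup K (inertia K G (dualIdempotent η))) (hχ : χ ∈ rightOrbit G η η') :
    psiDual γ χ ∈ rightOrbit G η η' := by
  obtain ⟨δ, hδ, rfl⟩ := hχ
  exact ⟨δ * γ, mul_mem_perpGroup hδ hγ, (psiDual_psiDual δ γ η').symm⟩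

end OrbitDefinitions

section Orbits

variable {K G A : Type*} [Field K] [IsAlgClosed K] [CommGroup G] [CommRing A]
  [Algebra K A] [IsSemisimpleRing A] [Module.Finite K A]
  [Coalgebra K A] [Module (MonoidAlgebra K G) A] [IsScalarTower K (MonoidAlgebra K G) A]
  [YDHopfAlgebra K (MonoidAlgebra K G) A]

lemma mem_inertia_dualIdempotent {g : G} {χ : A →ₐ[K] K} :
    g ∈ inertia K G (dualIdempotent χ) ↔ phiDual g χ = χ := by
  change phi K A g _ = _ ↔ _
  rw [phi_dualIdempotent, dualIdempotent_injective.eq_iff]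
  refine ⟨fun h => ?_, fun h => ?_⟩
  · conv_lhs => rw [← h]
    rw [phiDual_phiDual, inv_mul_cancel, phiDual_one]
  · conv_lhs => rw [← h]
    rw [phiDual_phiDual, mul_inv_cancel, phiDual_one]

lemma orbitO_dualIdempotent (η η' : A →ₐ[K] K) :
    orbitO K G (dualIdempotent η) (dualIdempotent η') =
      dualIdempotent '' leftOrbit G η η' := by
  rw [leftOrbit, Set.image_image, orbitO]
  ext f
  constructor
  · rintro ⟨g, hg, rfl⟩
    exact ⟨g⁻¹, inv_mem_perpChars hg, (phi_dualIdempotent g η).symm⟩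
  · rintro ⟨g, hg, rfl⟩
    exact ⟨g⁻¹, inv_mem_perpChars hg, by simp only [phi_dualIdempotent, inv_inv]⟩

variable [Fintype G]

lemma psi_dualIdempotent (γ : G →* Kˣ) (χ : A →ₐ[K] K) :
    psi A γ (dualIdempotent χ) = dualIdempotent (psiDual γ⁻¹ χ) := by
  have h := map_dualIdempotent_comp (psiEquiv A γ) (psiDual γ⁻¹ χ)
  change psi A γ (dualIdempotent (psiDual γ (psiDual γ⁻¹ χ))) = _ at h
  rwa [psiDual_psiDual, show γ⁻¹ * γ = 1 from inv_mul_cancel γ, psiDual_one] at h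

lemma psiDual_eq_of_mem_isotropy {γ : G →* Kˣ} {χ : A →ₐ[K] K}
    (h : γ ∈ isotropy K G (dualIdempotent χ)) : psiDual γ χ = χ := by
  have h1 : psi A γ _ = _ := h
  rw [psi_dualIdempotent, dualIdempotent_injective.eq_iff] at h1
  conv_lhs => rw [← h1]
  rw [psiDual_psiDual, show γ⁻¹ * γ = 1 from inv_mul_cancel γ, psiDual_one]

lemma orbitO'_dualIdempotent (η η' : A →ₐ[K] K) :
    orbitO' K G (dualIdempotent η) (dualIdempotent η') =
      dualIdempotent '' rightOrbit G η η' := by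
  rw [rightOrbit, Set.image_image, orbitO']
  ext f
  constructor
  · rintro ⟨γ, hγ, rfl⟩
    exact ⟨γ⁻¹, inv_mem_perpGroup hγ, (psi_dualIdempotent γ η').symm⟩
  · rintro ⟨γ, hγ, rfl⟩
    refine ⟨γ⁻¹, inv_mem_perpGroup hγ, ?_⟩
    simp only [psi_dualIdempotent, show γ⁻¹⁻¹ = γ from inv_inv γ]

variable (G) in
/-- The span of the products `η_f η_{f'}` with `f ∈ O` and `f' ∈ O'`. -/
def productSpan (η η' : A →ₐ[K] K) : Submodule K (Module.Dual K A) :=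
  Submodule.span K (Set.image2 (fun χ χ' : A →ₐ[K] K => dualMul χ.toLinearMap χ'.toLinearMap)
    (leftOrbit G η η') (rightOrbit G η η'))

/-- The components of degree `k` with `k ∉ Q_{e'}^⊥` do not contribute to `η' = η_{e'}`. -/
lemma comp_component_eq_zero {η' : A →ₐ[K] K} {k : G}
    (hk : k ∉ perpChars (isotropy K G (dualIdempotent η'))) :
    η'.toLinearMap ∘ₗ component K A k = 0 := by
  obtain ⟨γ, hγ, hγk⟩ : ∃ γ ∈ isotropy K G (dualIdempotent η'), γ k ≠ 1 := by
    simpa [perpChars] using hk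
  refine LinearMap.ext fun a => ?_
  have h := DFunLike.congr_fun (psiDual_eq_of_mem_isotropy hγ) (component K A k a)
  rw [psiDual_apply, psi_component, map_smul, smul_eq_mul] at h
  have h2 : ((γ k : K) - 1) * η' (component K A k a) = 0 := by rw [sub_mul, h, one_mul, sub_self]
  exact (mul_eq_zero.1 h2).resolve_left
    (sub_ne_zero.2 fun h3 => hγk (Units.ext (by simpa using h3)))

/-- The span of the products is stable under translations, by the product formula: the terms that
would leave it vanish by `comp_component_eq_zero`. -/
lemma productSpan_comp_mul (η η' : A →ₐ[K] K) :
    ∀ w ∈ productSpan G η η', ∀ a : A, w ∘ₗ LinearMap.mul K A a ∈ productSpan G η η' := by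
  intro w hw a
  induction hw using Submodule.span_induction with
  | zero => simp
  | add x y _ _ hx hy => rw [LinearMap.add_comp]; exact add_mem hx hy
  | smul c x _ hx => rw [LinearMap.smul_comp]; exact Submodule.smul_mem _ c hx
  | mem w hw =>
    obtain ⟨_, ⟨g, hg, rfl⟩, _, ⟨γ, hγ, rfl⟩, rfl⟩ := hw
    have h : dualMul (phiDual g η).toLinearMap (psiDual γ η').toLinearMap ∘ₗ LinearMap.mul K A a =
        (γ g : K)⁻¹ • ∑ k : G,
          (dualMul (phiDual g η).toLinearMap (η'.toLinearMap ∘ₗ component K A k) a *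
            (γ (g * k) : Kˣ)) •
          dualMul (phiDual (g * k) η).toLinearMap (psiDual γ η').toLinearMap := by
      refine LinearMap.ext fun b => ?_
      have h := rescaled_dualMul_apply_mul η η' g γ a b
      simp only [LinearMap.comp_apply, LinearMap.mul_apply', LinearMap.smul_apply,
        LinearMap.sum_apply, smul_eq_mul, mul_assoc] at h ⊢
      rw [← h, inv_mul_cancel_left₀ (Units.ne_zero _)]
    simp only [h]
    refine Submodule.smul_mem _ _ (Submodule.sum_mem _ fun k _ => ?_)
    by_cases hk : k ∈ perpChars (isotropy K G (dualIdempotent η'))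
    · exact Submodule.smul_mem _ _ (Submodule.subset_span
        ⟨_, ⟨g * k, mul_mem_perpChars hg hk, rfl⟩, _, ⟨γ, hγ, rfl⟩, rfl⟩)
    · rw [comp_component_eq_zero hk]
      simp [dualMul_apply]

variable (G) in
/-- The characters that occur in the products `η_f η_{f'}` with `f ∈ O` and `f' ∈ O'`. -/
def support (η η' : A →ₐ[K] K) : Set (A →ₐ[K] K) :=
  {χ | ∃ w ∈ productSpan G η η', w (dualIdempotent χ) ≠ 0}

lemma productSpan_eq_span_support (η η' : A →ₐ[K] K) :
    productSpan G η η' = Submodule.span K (AlgHom.toLinearMap '' support G η η') :=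
  eq_span_characters (productSpan_comp_mul η η')

lemma mem_support_iff {η η' χ : A →ₐ[K] K} :
    χ ∈ support G η η' ↔ χ.toLinearMap ∈ productSpan G η η' := by
  classical
  refine ⟨fun h => ?_, fun h => ⟨_, h, by simp [apply_dualIdempotent]⟩⟩
  rw [productSpan_eq_span_support]
  exact Submodule.subset_span ⟨χ, h, rfl⟩

/-- The products `χη'` with `χ` in the orbit of `η` are linearly independent, because
multiplication by `η'` is injective. -/
lemma ncard_leftOrbit_le (η η' : A →ₐ[K] K) :
    (leftOrbit G η η').ncard ≤ (support G η η').ncard := by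
  have hli : LinearIndependent K (fun χ : leftOrbit G η η' =>
      dualMulRight η'.toLinearMap (χ : A →ₐ[K] K).toLinearMap) :=
    ((linearIndependent_algHom_toLinearMap K A K).comp _ Subtype.val_injective).map'
      (dualMulRight η'.toLinearMap) (LinearMap.ker_eq_bot.2 (dualMulRight_injective
        (YDHopfAlgebra.mul_antipode_lTensor_comul (K := K) (H := MonoidAlgebra K G) (A := A)) η'))
  have hmem (χ : leftOrbit G η η') :
      dualMulRight η'.toLinearMap (χ : A →ₐ[K] K).toLinearMap ∈ productSpan G η η' :=
    Submodule.subset_span ⟨χ, χ.2, η', self_mem_rightOrbit η η', rfl⟩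
  have hli2 : LinearIndependent K (fun χ : leftOrbit G η η' =>
      (⟨_, hmem χ⟩ : productSpan G η η')) :=
    LinearIndependent.of_comp (productSpan G η η').subtype hli
  have := Fintype.ofFinite (leftOrbit G η η')
  have := Fintype.ofFinite (support G η η')
  classical
  calc (leftOrbit G η η').ncard = Fintype.card (leftOrbit G η η') :=
        by rw [← Nat.card_coe_set_eq, Nat.card_eq_fintype_card]
    _ ≤ Module.finrank K (productSpan G η η') := hli2.fintype_card_le_finrank
    _ = Module.finrank K
        (Submodule.span K (AlgHom.toLinearMap '' support G η η')) := by
          rw [productSpan_eq_span_support]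
    _ ≤ (AlgHom.toLinearMap '' support G η η').toFinset.card := finrank_span_le_card _
    _ = (AlgHom.toLinearMap '' support G η η').ncard := (Set.ncard_eq_toFinset_card' _).symm
    _ ≤ (support G η η').ncard := Set.ncard_image_le (Set.toFinite _)

/-- The coefficients `(η ∘ φ_g)(η' ∘ pₖ)` define an action of `A` on the functions on `O`. The
idempotents of the characters in the support act as nonzero orthogonal projections, so that there
are at most `|O|` of them. -/
lemma ncard_support_le (η η' : A →ₐ[K] K) :
    (support G η η').ncard ≤ (leftOrbit G η η').ncard := by
  classical
  have := Fintype.ofFinite (leftOrbit G η η')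
  have := Fintype.ofFinite (support G η η')
  set J := perpChars (isotropy K G (dualIdempotent η')) with hJ
  have hex (χ : support G η η') : ∃ γ ∈ perpGroup K (inertia K G (dualIdempotent η)), ∃ g ∈ J,
      dualMul (phiDual g η).toLinearMap (psiDual γ η').toLinearMap
        (dualIdempotent (χ : A →ₐ[K] K)) ≠ 0 := by
    by_contra! h
    obtain ⟨w, hw, hne⟩ := χ.2
    refine hne ?_
    clear hne
    induction hw using Submodule.span_induction with
    | zero => simp
    | add x y _ _ hx hy => simp [hx, hy]
    | smul c x _ hx => simp [hx]
    | mem w hw =>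
      obtain ⟨_, ⟨g, hg, rfl⟩, _, ⟨γ, hγ, rfl⟩, rfl⟩ := hw
      exact h γ hγ g hg
  choose γ hγ g₀ hg₀ hne using hex
  let v (χ : support G η η') (g : G) : K := (γ χ g : K) *
    dualMul (phiDual g η).toLinearMap (psiDual (γ χ) η').toLinearMap
      (dualIdempotent (χ : A →ₐ[K] K))
  -- `v χ` factors over the orbit, because `γ χ` is trivial on the inertia group
  have hv (χ : support G η η') {g h : G} (hgh : phiDual g η = phiDual h η) : v χ g = v χ h := by
    have hmem : h * g⁻¹ ∈ inertia K G (dualIdempotent η) := by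
      rw [mem_inertia_dualIdempotent, ← phiDual_phiDual, ← hgh, phiDual_phiDual, mul_inv_cancel,
        phiDual_one]
    have h1 : γ χ h = γ χ g := by
      have h2 := hγ χ _ hmem
      rwa [map_mul, map_inv, mul_inv_eq_one] at h2
    simp only [v, hgh, h1]
  -- the idempotent of `χ` acts as a projection onto the line spanned by `v χ`
  have hmul (χ ω : support G η η') (g : G) :
      (if χ = ω then v ω g else 0) =
        ∑ k : G, dualMul (phiDual g η).toLinearMap (η'.toLinearMap ∘ₗ component K A k)
          (dualIdempotent (χ : A →ₐ[K] K)) * v ω (g * k) := by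
    rw [← rescaled_dualMul_apply_mul, dualIdempotent_mul_dualIdempotent]
    simp only [Subtype.ext_iff]
    split_ifs
    · rfl
    · simp
  have hsec (χ : leftOrbit G η η') : ∃ g ∈ J, phiDual g η = χ := χ.2
  choose s hs hs' using hsec
  have hli : LinearIndependent K (fun χ : support G η η' =>
      fun o : leftOrbit G η η' => v χ (s o)) := by
    rw [Fintype.linearIndependent_iff]
    intro c hc χ
    have hc' (g : G) (hg : g ∈ J) : ∑ ω, c ω * v ω g = 0 := by
      have h := congrFun hc ⟨phiDual g η, g, hg, rfl⟩
      rw [Finset.sum_apply, Pi.zero_apply] at h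
      simpa only [Pi.smul_apply, smul_eq_mul, hv _ (hs' ⟨phiDual g η, g, hg, rfl⟩)] using h
    have h : c χ * v χ (g₀ χ) = 0 := by
      have h1 : c χ * v χ (g₀ χ) = ∑ ω, c ω * (if χ = ω then v ω (g₀ χ) else 0) := by simp
      simp only [h1, hmul, Finset.mul_sum]
      rw [Finset.sum_comm]
      refine Finset.sum_eq_zero fun k _ => ?_
      by_cases hk : k ∈ J
      · have h2 := hc' _ (mul_mem_perpChars (hg₀ χ) hk)
        simp only [mul_left_comm (c _), ← Finset.mul_sum, h2, mul_zero]
      · simp [comp_component_eq_zero hk, dualMul_apply]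
    exact (mul_eq_zero.1 h).resolve_right (mul_ne_zero (Units.ne_zero _) (hne χ))
  have h := hli.fintype_card_le_finrank
  rw [Module.finrank_fintype_fun_eq_card] at h
  rwa [← Nat.card_eq_fintype_card, ← Nat.card_eq_fintype_card, Nat.card_coe_set_eq,
    Nat.card_coe_set_eq] at h

lemma ncard_support (η η' : A →ₐ[K] K) :
    (support G η η').ncard = (leftOrbit G η η').ncard :=
  le_antisymm (ncard_support_le η η') (ncard_leftOrbit_le η η')

end Orbits

section Stability

variable {K G A : Type*} [Field K] [IsAlgClosed K] [CommGroup G] [Fintype G] [CommRing A]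
  [Algebra K A] [IsSemisimpleRing A] [Module.Finite K A]
  [Coalgebra K A] [Module (MonoidAlgebra K G) A] [IsScalarTower K (MonoidAlgebra K G) A]
  [YDHopfAlgebra K (MonoidAlgebra K G) A]

/-- The transpose of an automorphism that preserves the coproduct and both orbits permutes the
support. -/
lemma dualMap_image_support {η η' : A →ₐ[K] K} (θ : A ≃ₐ[K] A)
    (hθ : ∀ a, Coalgebra.comul (R := K) (θ a) = TensorProduct.map θ.toLinearMap θ.toLinearMap
      (Coalgebra.comul (R := K) a))
    (hl : ∀ χ ∈ leftOrbit G η η', χ.comp θ.toAlgHom ∈ leftOrbit G η η')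
    (hr : ∀ χ ∈ rightOrbit G η η', χ.comp θ.toAlgHom ∈ rightOrbit G η η') :
    θ.toLinearMap.dualMap '' (AlgHom.toLinearMap '' support G η η') =
      AlgHom.toLinearMap '' support G η η' := by
  have hspan : productSpan G η η' ≤ (productSpan G η η').comap θ.toLinearMap.dualMap := by
    refine Submodule.span_le.2 ?_
    rintro _ ⟨χ, hχ, χ', hχ', rfl⟩
    rw [SetLike.mem_coe, Submodule.mem_comap, LinearMap.dualMap_apply']
    have h := dualMul_comp (θ := θ.toLinearMap) hθ χ.toLinearMap χ'.toLinearMap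
    rw [h]
    exact Submodule.subset_span ⟨_, hl χ hχ, _, hr χ' hχ', rfl⟩
  have hmaps : θ.toLinearMap.dualMap '' (AlgHom.toLinearMap '' support G η η') ⊆
      AlgHom.toLinearMap '' support G η η' := by
    rintro _ ⟨_, ⟨χ, hχ, rfl⟩, rfl⟩
    refine ⟨χ.comp θ.toAlgHom, ?_, rfl⟩
    exact mem_support_iff.2 (hspan (mem_support_iff.1 hχ))
  have hinj : Function.Injective θ.toLinearMap.dualMap :=
    LinearMap.dualMap_injective_of_surjective θ.surjective
  exact Set.eq_of_subset_of_ncard_le hmaps (Set.ncard_image_of_injective _ hinj).ge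

end Stability

end YetterDrinfeld
end
theorem theorem3p3 {K G A : Type*} [Field K] [IsAlgClosed K] [CharZero K]
    [CommGroup G] [Finite G]
    [CommRing A] [Algebra K A] [IsSemisimpleRing A] [Coalgebra K A]
    [Module (MonoidAlgebra K G) A] [IsScalarTower K (MonoidAlgebra K G) A]
    [YetterDrinfeld.YDHopfAlgebra K (MonoidAlgebra K G) A] :
    -- the characters `η_e` are well defined
    (∀ e : A, YetterDrinfeld.IsPrimitiveIdempotent e →
      ∃! η : A →ₐ[K] K, YetterDrinfeld.IsCharacterOf K e η) ∧
    ∀ e e' : A, YetterDrinfeld.IsPrimitiveIdempotent e →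
      YetterDrinfeld.IsPrimitiveIdempotent e' →
      ∃ ω : Fin (YetterDrinfeld.orbitO K G e e').ncard → (A →ₐ[K] K),
        Function.Injective ω ∧
        (∀ f ∈ YetterDrinfeld.orbitO K G e e', ∀ f' ∈ YetterDrinfeld.orbitO' K G e e',
          YetterDrinfeld.dualMul (YetterDrinfeld.eta K f) (YetterDrinfeld.eta K f') ∈
            Submodule.span K (Set.range fun k => (ω k).toLinearMap)) ∧
        YetterDrinfeld.dualMul (YetterDrinfeld.eta K e) (YetterDrinfeld.eta K e') ∈
          Submodule.span K (Set.range fun k => (ω k).toLinearMap) ∧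
        (∀ γ ∈ YetterDrinfeld.perpGroup K (YetterDrinfeld.inertia K G e),
          Set.MapsTo (YetterDrinfeld.psi A γ)
            (YetterDrinfeld.orbitO K G e e') (YetterDrinfeld.orbitO K G e e') →
          (YetterDrinfeld.psi A γ).dualMap '' (Set.range fun k => (ω k).toLinearMap) =
            Set.range fun k => (ω k).toLinearMap) ∧
        (∀ g ∈ YetterDrinfeld.perpChars (YetterDrinfeld.isotropy K G e'),
          Set.MapsTo (YetterDrinfeld.phi K A g)
            (YetterDrinfeld.orbitO' K G e e') (YetterDrinfeld.orbitO' K G e e') →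
          (YetterDrinfeld.phi K A g).dualMap '' (Set.range fun k => (ω k).toLinearMap) =
            Set.range fun k => (ω k).toLinearMap) := by

  classical
  have := Fintype.ofFinite G
  have : Module.Finite K A := YetterDrinfeld.finite_of_isSemisimpleRing K G A
  refine ⟨fun e he => ?_, fun e e' he he' => ?_⟩
  · obtain ⟨χ, rfl⟩ := he.exists_eq_dualIdempotent (K := K)
    exact ⟨χ, YetterDrinfeld.isCharacterOf_dualIdempotent_iff.2 rfl,
      fun ω hω => YetterDrinfeld.isCharacterOf_dualIdempotent_iff.1 hω⟩
  obtain ⟨η, rfl⟩ := he.exists_eq_dualIdempotent (K := K)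
  obtain ⟨η', rfl⟩ := he'.exists_eq_dualIdempotent (K := K)
  rw [YetterDrinfeld.orbitO_dualIdempotent, YetterDrinfeld.orbitO'_dualIdempotent]
  have hcard : Nat.card (YetterDrinfeld.support G η η') =
      (YetterDrinfeld.dualIdempotent '' YetterDrinfeld.leftOrbit G η η').ncard := by
    rw [Set.ncard_image_of_injective _ YetterDrinfeld.dualIdempotent_injective,
      ← YetterDrinfeld.ncard_support, Nat.card_coe_set_eq]
  let ω := (Finite.equivFinOfCardEq hcard).symm
  have hrange : (Set.range fun k => (ω k : A →ₐ[K] K).toLinearMap) =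
      AlgHom.toLinearMap '' YetterDrinfeld.support G η η' := by
    rw [Set.range_comp' AlgHom.toLinearMap fun k => (ω k : A →ₐ[K] K),
      Set.range_comp' Subtype.val ω, ω.surjective.range_eq, Set.image_univ, Subtype.range_coe]
  have hmem (χ χ' : A →ₐ[K] K) (hχ : χ ∈ YetterDrinfeld.leftOrbit G η η')
      (hχ' : χ' ∈ YetterDrinfeld.rightOrbit G η η') :
      YetterDrinfeld.dualMul (YetterDrinfeld.eta K (YetterDrinfeld.dualIdempotent χ))
        (YetterDrinfeld.eta K (YetterDrinfeld.dualIdempotent χ')) ∈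
        Submodule.span K (AlgHom.toLinearMap '' YetterDrinfeld.support G η η') := by
    rw [YetterDrinfeld.eta_dualIdempotent, YetterDrinfeld.eta_dualIdempotent,
      ← YetterDrinfeld.productSpan_eq_span_support]
    exact Submodule.subset_span ⟨χ, hχ, χ', hχ', rfl⟩
  refine ⟨fun k => ω k, Subtype.val_injective.comp ω.injective, ?_⟩
  rw [hrange]
  refine ⟨?_, ?_, fun γ hγ hO => ?_, fun g hg hO' => ?_⟩
  · rintro _ ⟨χ, hχ, rfl⟩ _ ⟨χ', hχ', rfl⟩
    exact hmem χ χ' hχ hχ'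
  · exact hmem η η' (YetterDrinfeld.self_mem_leftOrbit η η')
      (YetterDrinfeld.self_mem_rightOrbit η η')
  · exact YetterDrinfeld.dualMap_image_support (YetterDrinfeld.psiEquiv A γ)
      (YetterDrinfeld.comul_psi γ)
      (fun χ hχ => YetterDrinfeld.comp_mem_of_mapsTo (YetterDrinfeld.psiEquiv A γ) hO hχ)
      (fun χ hχ => YetterDrinfeld.psiDual_mem_rightOrbit hγ hχ)
  · exact YetterDrinfeld.dualMap_image_support (YetterDrinfeld.phiEquiv K A g)
      (YetterDrinfeld.comul_phi g)
      (fun χ hχ => YetterDrinfeld.phiDual_mem_leftOrbit hg hχ)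
      (fun χ hχ => YetterDrinfeld.comp_mem_of_mapsTo (YetterDrinfeld.phiEquiv K A g) hO' hχ)
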